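/- **Theorem.** *Setting.* Let $m\ge 1$ and let $\mathcal G$ be a weighted directed graph on the agents $0$ (the source) and $1,\dots,m$ (the sensing nodes), with weights $w_{ij}\ge 0$; agent $i$ receives information from agent $j$ iff $w_{ij}>0$. Put $[\mathbb A_m]_{ij}=w_{ij}$ for $1\le i,j\le m$, $d_i=\sum_{j=1}^m w_{ij}$, $\mathbb A_0=\mathrm{diag}\{w_{10},\dots,w_{m0}\}$ and $\mathbb L=\mathrm{diag}\{d_1,\dots,d_m\}-\mathbb A_m+\mathbb A_0$. Assume the graph is balanced, $d_i+w_{i0}=1$ for all $i\in\{1,\dots,m\}$, and that the source is reachable: $w_{i0}>0$ for some $i$, and every sensing node is reached from the source by a directed path. Let $F_0\in\mathbb R^{n\times n}$, $G_0\in\mathbb R^{n\times p}$, let $H_1,\dots,H_m\in\mathbb R^{n\times n}$ be Hurwitz, and put $\mathbf F_0=I_m\otimes F_0$, $\mathbf G_0=I_m\otimes G_0$, $\mathbf H=\mathrm{diag}\{H_1,\dots,H_m\}$. Assume that $$\mathcal H=(\mathbb L\otimes I_n)\mathbf H+(\mathbb A_m\otimes I_n)\mathbf F_0$$ is Hurwitz,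 let $P_c,Q_c$ be symmetric positive definite with $\mathcal H^\top P_c+P_c\mathcal H=-Q_c$, and let $\Gamma_\phi,\Gamma_\psi\in\mathbb R^{mn\times mn}$ be symmetric positive definite. On $[0,\infty)$, let $v_0(t)\in\mathbb R^p$ be an input and let $x_0(t)\in\mathbb R^n$, $\bar x(t)\in\mathbb R^{mn}$, $\hat{\mathbf F}(t)\in\mathbb R^{mn\times mn}$, $\hat{\mathbf G}(t)\in\mathbb R^{mn\times mp}$ be differentiable functions satisfying, with $\bar x_0=\mathbf 1_m\otimes x_0$ and $\bar v_0=\mathbf 1_m\otimes v_0$, $$\dot x_0=F_0x_0+G_0v_0,\qquad \dot{\bar x}=\mathbf H\bar x+(\hat{\mathbf F}-\mathbf H)\bar z+\hat{\mathbf G}\bar v_0,\qquad \bar z=(\mathbb A_m\otimes I_n)\bar x+(\mathbb A_0\otimes I_n)\bar x_0,$$ and, with $\bar e=\bar x-\bar z$, $\Phi_c=\hat{\mathbf F}-\mathbf F_0$, $\Psi_c=\hat{\mathbf G}-\mathbf G_0$, the adaptive laws $$\dot\Phi_c=-\Gamma_\phi(\mathbb L\otimes I_n)^\top P_c\,\bar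 e\,\bar z^\top,\qquad \dot\Psi_c=-\Gamma_\psi(\mathbb L\otimes I_n)^\top P_c\,\bar e\,\bar v_0^\top .$$ *Conclusion.* 1. The signals $\bar e$, $\Phi_c$, $\Psi_c$, $\hat{\mathbf F}$ and $\hat{\mathbf G}$ are bounded on $[0,\infty)$. 2. If the source state $x_0$ is bounded on $[0,\infty)$, then so are $\bar x$ and $\bar z$; thus all closed-loop signals are bounded. 3. If the input $v_0$ is bounded on $[0,\infty)$, then $\bar e(t)\to 0$ as $t\to\infty$. -/

import Mathlib

open scoped Kronecker Matrix Topology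

namespace AdaptiveNetwork

/-- A weighted directed graph on the agents `0, 1, …, m`: agent `0` is the source and the agents
`i.succ`, `i : Fin m`, are the sensing nodes. `w i j` is the weight with which agent `i` receives
information from agent `j`; `(i, j)` is an edge exactly when `w i j > 0`. -/
structure Network (m : ℕ) where
  w : Fin (m + 1) → Fin (m + 1) → ℝ
  w_nonneg : ∀ i j, 0 ≤ w i j

namespace Network

variable {m : ℕ} (N : Network m)

/-- In-degree of sensing node `i` in the sensing-only subgraph. -/
def inDegree (i : Fin m) : ℝ := ∑ j : Fin m, N.w i.succ j.succ

/-- `𝔻_m`, the in-degree matrix of the sensing subgraph. -/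
def degreeMatrix : Matrix (Fin m) (Fin m) ℝ := Matrix.diagonal N.inDegree

/-- `𝔸_m`, the adjacency matrix of the sensing subgraph. -/
def adjacency : Matrix (Fin m) (Fin m) ℝ := Matrix.of fun i j => N.w i.succ j.succ

/-- `𝕃_m = 𝔻_m - 𝔸_m`, the Laplacian of the sensing subgraph. -/
def laplacian : Matrix (Fin m) (Fin m) ℝ := N.degreeMatrix - N.adjacency

/-- `𝔸_0`, the diagonal matrix of source-to-sensing weights. -/
def sourceAdjacency : Matrix (Fin m) (Fin m) ℝ := Matrix.diagonal fun i => N.w i.succ 0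

/-- `𝕎`, the diagonal matrix of total incoming weights. -/
def totalWeight : Matrix (Fin m) (Fin m) ℝ :=
  Matrix.diagonal fun i => N.inDegree i + N.w i.succ 0

/-- `𝕃 = 𝕃_m + 𝔸_0`, the augmented Laplacian. -/
def augLaplacian : Matrix (Fin m) (Fin m) ℝ := N.laplacian + N.sourceAdjacency

/-- The balanced condition `𝕎 = I_m`. -/
def Balanced : Prop := N.totalWeight = 1

/-- Some sensing node hears the source directly, and every sensing node is reachable from the
source along a directed path (information flows from `a` to `b` when `w b a > 0`). -/
def SourceReachable : Prop :=
  (∃ i : Fin m, 0 < N.w i.succ 0) ∧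
    ∀ i : Fin m, Relation.ReflTransGen (fun a b => 0 < N.w b a) 0 i.succ

end Network

/-- `A ⊗ I_n`. -/
def kronI {m : ℕ} (A : Matrix (Fin m) (Fin m) ℝ) (n : ℕ) :
    Matrix (Fin m × Fin n) (Fin m × Fin n) ℝ :=
  A ⊗ₖ (1 : Matrix (Fin n) (Fin n) ℝ)

/-- `𝟏_m ⊗ β`, that is `m` stacked copies of the vector `β`. -/
def stackSource (m : ℕ) {q : ℕ} (β : Fin q → ℝ) : Fin m × Fin q → ℝ := fun ia => β ia.2

/-- `I_m ⊗ E`. -/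
def replicate (m : ℕ) {q r : ℕ} (E : Matrix (Fin q) (Fin r) ℝ) :
    Matrix (Fin m × Fin q) (Fin m × Fin r) ℝ :=
  (1 : Matrix (Fin m) (Fin m) ℝ) ⊗ₖ E

/-- `diag{E_1, …, E_m}`, with the block number as the first index. -/
def blockDiag {m q r : ℕ} (E : Fin m → Matrix (Fin q) (Fin r) ℝ) :
    Matrix (Fin m × Fin q) (Fin m × Fin r) ℝ :=
  Matrix.of fun ia jb => if ia.1 = jb.1 then E ia.1 ia.2 jb.2 else 0

/-- All complex eigenvalues have negative real part. -/
def IsHurwitz {ι : Type*} [Fintype ι] [DecidableEq ι] (A : Matrix ι ι ℝ) : Prop :=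
  ∀ μ ∈ spectrum ℂ (A.map (algebraMap ℝ ℂ)), μ.re < 0

variable {m n p : ℕ}

/-- The coupling operator `𝓗 = (𝕃 ⊗ I_n) 𝐇 + (𝔸_m ⊗ I_n) 𝐅₀`. -/
def couplingOperator (N : Network m) (H : Fin m → Matrix (Fin n) (Fin n) ℝ)
    (F₀ : Matrix (Fin n) (Fin n) ℝ) : Matrix (Fin m × Fin n) (Fin m × Fin n) ℝ :=
  kronI N.augLaplacian n * blockDiag H + kronI N.adjacency n * replicate m F₀

/-- The aggregate `z̄ = (𝔸_m ⊗ I_n) x̄ + (𝔸_0 ⊗ I_n) ȳ₀`, where `y₀ = x₀`. -/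
def aggregate (N : Network m) (x₀ : Fin n → ℝ) (x : Fin m × Fin n → ℝ) : Fin m × Fin n → ℝ :=
  kronI N.adjacency n *ᵥ x + kronI N.sourceAdjacency n *ᵥ stackSource m x₀

/-- The estimation error `ē = x̄ - z̄`. -/
def estError (N : Network m) (x₀ : Fin n → ℝ) (x : Fin m × Fin n → ℝ) : Fin m × Fin n → ℝ :=
  x - aggregate N x₀ x

/-- The parameter error `Ê - I_m ⊗ E₀`. -/
def paramError {q r : ℕ} (E₀ : Matrix (Fin q) (Fin r) ℝ)
    (Ehat : Matrix (Fin m × Fin q) (Fin m × Fin r) ℝ) :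
    Matrix (Fin m × Fin q) (Fin m × Fin r) ℝ :=
  Ehat - replicate m E₀

/-- The signals `x₀, x̄, F̂, Ĝ` form a trajectory on `[0, ∞)` of the disturbance-free source, the
sensing network and the adaptive laws, with input `v₀`. The adaptive laws are equalities of
matrices, differentiated entry by entry; the parameter estimates may be arbitrary matrices of the
given size, block diagonal ones included. -/
structure IsClosedLoop (N : Network m)
    (F₀ : Matrix (Fin n) (Fin n) ℝ) (G₀ : Matrix (Fin n) (Fin p) ℝ)
    (H : Fin m → Matrix (Fin n) (Fin n) ℝ)
    (P Γφ Γψ : Matrix (Fin m × Fin n) (Fin m × Fin n) ℝ)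
    (v₀ : ℝ → Fin p → ℝ) (x₀ : ℝ → Fin n → ℝ) (x : ℝ → Fin m × Fin n → ℝ)
    (Fhat : ℝ → Matrix (Fin m × Fin n) (Fin m × Fin n) ℝ)
    (Ghat : ℝ → Matrix (Fin m × Fin n) (Fin m × Fin p) ℝ) : Prop where
  source : ∀ t ≥ (0 : ℝ),
    HasDerivWithinAt x₀ (F₀ *ᵥ x₀ t + G₀ *ᵥ v₀ t) (Set.Ici 0) t
  sensors : ∀ t ≥ (0 : ℝ),
    HasDerivWithinAt x
      (blockDiag H *ᵥ x t + (Fhat t - blockDiag H) *ᵥ aggregate N (x₀ t) (x t)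
        + Ghat t *ᵥ stackSource m (v₀ t)) (Set.Ici 0) t
  lawF : ∀ t ≥ (0 : ℝ), ∀ a b,
    HasDerivWithinAt (fun s => paramError F₀ (Fhat s) a b)
      ((-(Γφ * (kronI N.augLaplacian n)ᵀ * P *
        Matrix.vecMulVec (estError N (x₀ t) (x t)) (aggregate N (x₀ t) (x t)))) a b)
      (Set.Ici 0) t
  lawG : ∀ t ≥ (0 : ℝ), ∀ a b,
    HasDerivWithinAt (fun s => paramError G₀ (Ghat s) a b)
      ((-(Γψ * (kronI N.augLaplacian n)ᵀ * P *
        Matrix.vecMulVec (estError N (x₀ t) (x t)) (stackSource m (v₀ t)))) a b)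
      (Set.Ici 0) t

/-- A vector signal is bounded on `[0, ∞)`. -/
def BoundedSignal {ι : Type*} [Fintype ι] (f : ℝ → ι → ℝ) : Prop :=
  ∃ C : ℝ, ∀ t ≥ (0 : ℝ), ‖f t‖ ≤ C

/-- A matrix signal is bounded on `[0, ∞)`. -/
def BoundedMatrixSignal {ι κ : Type*} (M : ℝ → Matrix ι κ ℝ) : Prop :=
  ∃ C : ℝ, ∀ t ≥ (0 : ℝ), ∀ a b, |M t a b| ≤ C

end AdaptiveNetwork

/-! Write `A` for the coupling operator, `B` for `𝕃 ⊗ I_n`, and `e`, `z`, `Φ`, `Ψ` for the errors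
and the aggregate. Balance gives `𝕃 = I - 𝔸_m` and `𝕃 𝟏 = 𝔸_0 𝟏`. These turn the closed loop into
`e' = A e + B Φ z + B Ψ v` (`error_field_eq`). The adaptive laws are gradient laws, so the energy `V
= eᵀ P e + tr(Φᵀ Γφ⁻¹ Φ) + tr(Ψᵀ Γψ⁻¹ Ψ)` satisfies `V' = -eᵀ Q e`, and all errors are bounded.
Reachability makes `B` invertible by a maximum principle, so `x̄` is recovered from `e` and `x₀`.

The difficulty is `e → 0` for bounded input: `x₀`, hence `z`, may grow exponentially, so `e'` need
not be bounded and Barbalat's lemma does not apply. Put `ρ = √(1 + |z|²)`, `ζ = z / ρ`, `σ = Φ ζ`.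
Then `e' = ρ B σ + O(1)` and `σ' = -ρ Γφ Bᵀ P e + O(1)`: a fast exchange between `e` and `σ` which
leaves `W = eᵀ P e + σᵀ Γφ⁻¹ σ` slowly varying. The derivative of `ρ⁻¹ e · B σ` equals `|B σ|²` up
to `O(eᵀ P e + 1/ρ)`, so on average `σ` cannot be large while `e` is small.

Since `z' = D z + d` with bounded `D` and `d`, `log ρ` is Lipschitz. On a short window `ρ` is
therefore either moderate, and `e` moves slowly, or large, and `W` is dissipated on average. If `eᵀ
P e` did not tend to `0`, then `V` would lose a fixed amount on arbitrarily late windows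
(`tendsto_zero_of_averaged_dissipation`, applied in `IsErrorSystem.tendsto_zero`). -/

namespace AdaptiveNetwork

/-! ### Scalar calculus on the half-line and the averaged Barbalat lemma. -/

/-- A function whose derivative is nonnegative on a subinterval of `[0, ∞)` increases there. -/
theorem le_of_hasDerivWithinAt_Ici_nonneg {f f' : ℝ → ℝ}
    (hf : ∀ t ≥ (0 : ℝ), HasDerivWithinAt f (f' t) (Set.Ici 0) t) {a b : ℝ} (ha : 0 ≤ a)
    (hab : a ≤ b) (h : ∀ s ∈ Set.Icc a b, 0 ≤ f' s) : f a ≤ f b := by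
  have hsub : Set.Icc a b ⊆ Set.Ici 0 := fun s hs => ha.trans hs.1
  refine monotoneOn_of_hasDerivWithinAt_nonneg (convex_Icc a b)
    (fun s hs => (hf s (hsub hs)).continuousWithinAt.mono hsub)
    (fun s hs => (hf s (hsub (interior_subset hs))).mono (interior_subset.trans hsub))
    (fun s hs => h s (interior_subset hs)) (Set.left_mem_Icc.2 hab) (Set.right_mem_Icc.2 hab) hab

theorem abs_sub_le_of_hasDerivWithinAt_Ici {f f' : ℝ → ℝ} {K : ℝ}
    (hf : ∀ t ≥ (0 : ℝ), HasDerivWithinAt f (f' t) (Set.Ici 0) t) {a b : ℝ} (ha : 0 ≤ a)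
    (hab : a ≤ b) (h : ∀ s ∈ Set.Icc a b, |f' s| ≤ K) : |f b - f a| ≤ K * (b - a) := by
  have hsub : Set.Icc a b ⊆ Set.Ici 0 := fun s hs => ha.trans hs.1
  have := (convex_Icc a b).norm_image_sub_le_of_norm_hasDerivWithin_le
    (fun s hs => (hf s (hsub hs)).mono hsub) h (Set.left_mem_Icc.2 hab) (Set.right_mem_Icc.2 hab)
  rwa [Real.norm_eq_abs, Real.norm_eq_abs, abs_of_nonneg (sub_nonneg.2 hab)] at this

/-- A nonnegative function that is nonincreasing on `[0, ∞)` eventually loses less than any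
prescribed amount over each window of fixed length. -/
theorem exists_forall_sub_lt_of_antitone {V : ℝ → ℝ} (hV : ∀ t ≥ (0 : ℝ), 0 ≤ V t)
    (hanti : ∀ a b, 0 ≤ a → a ≤ b → V b ≤ V a) {h η : ℝ} (hh : 0 ≤ h) (hη : 0 < η) :
    ∃ T ≥ (0 : ℝ), ∀ t ≥ T, V t - V (t + h) < η := by
  have hbdd : BddBelow (V '' Set.Ici 0) := ⟨0, by rintro _ ⟨t, ht, rfl⟩; exact hV t ht⟩
  have hne : (V '' Set.Ici 0).Nonempty := ⟨V 0, 0, Set.mem_Ici.2 le_rfl, rfl⟩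
  obtain ⟨_, ⟨T, hT, rfl⟩, hlt⟩ :=
    exists_lt_of_csInf_lt hne (lt_add_of_pos_right (sInf (V '' Set.Ici 0)) hη)
  refine ⟨T, hT, fun t ht => ?_⟩
  have h1 : sInf (V '' Set.Ici 0) ≤ V (t + h) :=
    csInf_le hbdd ⟨t + h, by have : (0 : ℝ) ≤ T := hT; simp only [Set.mem_Ici]; linarith, rfl⟩
  have h2 := hanti T t hT ht
  linarith

/-- An averaging form of Barbalat's lemma. The dissipated quantity `y` may move at the unbounded
speed `ρ`, provided that `ρ` has bounded logarithmic derivative and that `y` is dominated by a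
slowly varying energy `W` which is dissipated on average when `ρ` is large. -/
theorem tendsto_zero_of_averaged_dissipation {V V' y y' W W' χ χ' ρ ρ' : ℝ → ℝ} {C : ℝ}
    (hC : 0 < C)
    (dV : ∀ t ≥ (0 : ℝ), HasDerivWithinAt V (V' t) (Set.Ici 0) t)
    (dy : ∀ t ≥ (0 : ℝ), HasDerivWithinAt y (y' t) (Set.Ici 0) t)
    (dW : ∀ t ≥ (0 : ℝ), HasDerivWithinAt W (W' t) (Set.Ici 0) t)
    (dχ : ∀ t ≥ (0 : ℝ), HasDerivWithinAt χ (χ' t) (Set.Ici 0) t)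
    (dρ : ∀ t ≥ (0 : ℝ), HasDerivWithinAt ρ (ρ' t) (Set.Ici 0) t)
    (hV : ∀ t ≥ (0 : ℝ), 0 ≤ V t) (hy : ∀ t ≥ (0 : ℝ), 0 ≤ y t)
    (hyV : ∀ t ≥ (0 : ℝ), y t ≤ -(C * V' t))
    (hyW : ∀ t ≥ (0 : ℝ), y t ≤ W t) (hW' : ∀ t ≥ (0 : ℝ), |W' t| ≤ C)
    (hy' : ∀ t ≥ (0 : ℝ), |y' t| ≤ C * ρ t) (hρ : ∀ t ≥ (0 : ℝ), 1 ≤ ρ t)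
    (hρ' : ∀ t ≥ (0 : ℝ), |ρ' t| ≤ C * ρ t) (hχ : ∀ t ≥ (0 : ℝ), |χ t| ≤ C / ρ t)
    (hWχ : ∀ t ≥ (0 : ℝ), W t ≤ C * (χ' t + y t + 1 / ρ t)) :
    Filter.Tendsto y Filter.atTop (𝓝 0) := by
  have hV' : ∀ t ≥ (0 : ℝ), V' t ≤ 0 := fun t ht => by
    have := (hy t ht).trans (hyV t ht)
    by_contra! hpos
    nlinarith [mul_pos hC hpos]
  have hanti : ∀ a b, 0 ≤ a → a ≤ b → V b ≤ V a := fun a b ha hab => by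
    have := le_of_hasDerivWithinAt_Ici_nonneg (f := fun t => -V t) (f' := fun t => -V' t)
      (fun t ht => (dV t ht).neg) ha hab
      (fun s hs => by have := hV' s (ha.trans hs.1); linarith)
    linarith
  rw [Metric.tendsto_atTop]
  intro δ hδ
  -- The first bound keeps `W` within `δ / 2` of its initial value on a window of length `h`; the
  -- second keeps `ρ` within a factor `2`.
  set h : ℝ := min (δ / (2 * C)) (Real.log 2 / C) with hdef
  have hlog : 0 < Real.log 2 := Real.log_pos one_lt_two
  have hh : 0 < h := lt_min (by positivity) (by positivity)
  have hhδ : C * h ≤ δ / 2 := by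
    calc C * h ≤ C * (δ / (2 * C)) := mul_le_mul_of_nonneg_left (min_le_left _ _) hC.le
      _ = δ / 2 := by field_simp
  have hhlog : C * h ≤ Real.log 2 := by
    calc C * h ≤ C * (Real.log 2 / C) := mul_le_mul_of_nonneg_left (min_le_right _ _) hC.le
      _ = Real.log 2 := by field_simp
  -- Threshold between slow and fast `ρ`: above it, the boundary terms of `χ` and the integral of `1
  -- / ρ` cost at most `h * δ / 4`, half of what `W` contributes.
  set R : ℝ := 4 * (2 * C * h + 4 * C * C) / (h * δ) with hR
  have hRpos : 0 < R := by positivity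
  -- While `ρ t ≤ R`, `y` has speed at most `2 * C * R`, so it loses at most `δ / 2` in time `h₁`.
  set h₁ : ℝ := min h (δ / (4 * C * R)) with hh₁
  have hh₁pos : 0 < h₁ := lt_min hh (by positivity)
  -- The smaller of the losses of `V` forced in the fast and in the slow case.
  set η : ℝ := min (h * δ / (4 * (C * C))) (δ * h₁ / (2 * C)) with hη
  have hηpos : 0 < η := lt_min (by positivity) (by positivity)
  obtain ⟨T, hT0, hT⟩ := exists_forall_sub_lt_of_antitone hV hanti hh.le hηpos
  refine ⟨T, fun t ht => ?_⟩
  have ht0 : 0 ≤ t := hT0.trans ht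
  rw [Real.dist_eq, sub_zero, abs_of_nonneg (hy t ht0)]
  by_contra! hyt
  have hdrop := hT t ht
  have hlogρ : ∀ s ∈ Set.Icc t (t + h), |Real.log (ρ s) - Real.log (ρ t)| ≤ Real.log 2 := by
    intro s hs
    have := abs_sub_le_of_hasDerivWithinAt_Ici (f := fun s => Real.log (ρ s))
      (f' := fun s => ρ' s / ρ s) (K := C)
      (fun s hs => (dρ s hs).log (by have := hρ s hs; linarith)) ht0 hs.1
      (fun u hu => by
        have h0 := ht0.trans hu.1
        have h1 : 0 < ρ u := by have := hρ u h0; linarith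
        rw [abs_div, abs_of_pos h1, div_le_iff₀ h1]
        exact hρ' u h0)
    refine this.trans (le_trans ?_ hhlog)
    exact mul_le_mul_of_nonneg_left (by linarith [hs.2]) hC.le
  have hρt : 0 < ρ t := by linarith [hρ t ht0]
  have hup : ∀ s ∈ Set.Icc t (t + h), ρ s ≤ 2 * ρ t := fun s hs => by
    have hs0 : 0 < ρ s := by linarith [hρ s (ht0.trans hs.1)]
    have := (abs_le.1 (hlogρ s hs)).2
    rw [← Real.log_le_log_iff hs0 (by positivity), Real.log_mul two_ne_zero hρt.ne']
    linarith
  have hlow : ∀ s ∈ Set.Icc t (t + h), ρ t ≤ 2 * ρ s := fun s hs => by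
    have hs0 : 0 < ρ s := by linarith [hρ s (ht0.trans hs.1)]
    have := (abs_le.1 (hlogρ s hs)).1
    rw [← Real.log_le_log_iff hρt (by positivity), Real.log_mul two_ne_zero hs0.ne']
    linarith
  rcases le_total (ρ t) R with hcase | hcase
  · have hh₁h : h₁ ≤ h := min_le_left _ _
    have hyl : ∀ s ∈ Set.Icc t (t + h₁), δ / 2 ≤ y s := by
      intro s hs
      have hs0 := ht0.trans hs.1
      have := abs_sub_le_of_hasDerivWithinAt_Ici (K := 2 * C * R) dy ht0 hs.1 (fun u hu => by
        refine (hy' u (ht0.trans hu.1)).trans ?_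
        have := hup u ⟨hu.1, by linarith [hu.2, hs.2]⟩
        nlinarith)
      have h2 : 2 * C * R * (s - t) ≤ δ / 2 := by
        calc 2 * C * R * (s - t) ≤ 2 * C * R * (δ / (4 * C * R)) := by
              refine mul_le_mul_of_nonneg_left ?_ (by positivity)
              have : h₁ ≤ δ / (4 * C * R) := min_le_right _ _
              linarith [hs.2]
          _ = δ / 2 := by field_simp; norm_num
      linarith [(abs_le.1 this).1]
    -- Monotonicity of this function is the integrated form of `δ / 2 ≤ y ≤ -C V'`.
    have h3 := le_of_hasDerivWithinAt_Ici_nonneg (f := fun s => -(C * V s) - δ / 2 * s)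
      (f' := fun s => -(C * V' s) - δ / 2 * 1)
      (fun s hs => ((dV s hs).const_mul C).neg.sub ((hasDerivWithinAt_id s _).const_mul _))
      ht0 (by linarith : t ≤ t + h₁)
      (fun s hs => by linarith [hyl s hs, hyV s (ht0.trans hs.1)])
    have h4 := hanti (t + h₁) (t + h) (by linarith) (by linarith)
    have h5 : δ * h₁ / (2 * C) ≤ V t - V (t + h₁) := by
      rw [div_le_iff₀ (by positivity)]
      nlinarith
    linarith [min_le_right (h * δ / (4 * (C * C))) (δ * h₁ / (2 * C))]
  · have hWl : ∀ s ∈ Set.Icc t (t + h), δ / 2 ≤ W s := by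
      intro s hs
      have := abs_sub_le_of_hasDerivWithinAt_Ici (K := C) dW ht0 hs.1
        (fun u hu => hW' u (ht0.trans hu.1))
      have h2 : C * (s - t) ≤ C * h := mul_le_mul_of_nonneg_left (by linarith [hs.2]) hC.le
      linarith [(abs_le.1 this).1, hyW t ht0]
    have hinv : ∀ s ∈ Set.Icc t (t + h), 1 / ρ s ≤ 2 / R := fun s hs => by
      have hs0 : 0 < ρ s := by linarith [hρ s (ht0.trans hs.1)]
      rw [div_le_div_iff₀ hs0 hRpos]
      linarith [hlow s hs]
    have hχb : ∀ s ∈ Set.Icc t (t + h), |χ s| ≤ C * (2 / R) := fun s hs => by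
      refine (hχ s (ht0.trans hs.1)).trans ?_
      rw [div_eq_mul_one_div]
      exact mul_le_mul_of_nonneg_left (hinv s hs) hC.le
    -- Integrated form of `δ / 2 ≤ W ≤ C (χ' - C V' + 2 / R)`; only the boundary values of `χ`,
    -- which are of order `1 / R`, enter.
    have h3 := le_of_hasDerivWithinAt_Ici_nonneg
      (f := fun s => C * χ s - C * (C * V s) + (C * (2 / R) - δ / 2) * s)
      (f' := fun s => C * χ' s - C * (C * V' s) + (C * (2 / R) - δ / 2) * 1)
      (fun s hs => (((dχ s hs).const_mul C).sub (((dV s hs).const_mul C).const_mul C)).add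
        ((hasDerivWithinAt_id s _).const_mul _)) ht0 (by linarith : t ≤ t + h)
      (fun s hs => by
        have hs0 := ht0.trans hs.1
        have e1 := hWχ s hs0
        have e2 := mul_le_mul_of_nonneg_left (hyV s hs0) hC.le
        have e3 := mul_le_mul_of_nonneg_left (hinv s hs) hC.le
        linarith [hWl s hs])
    have h4 := (abs_le.1 (hχb t ⟨le_rfl, by linarith⟩)).1
    have h5 := (abs_le.1 (hχb (t + h) ⟨by linarith, le_rfl⟩)).2
    have h6 : (2 * C * h + 4 * C * C) / R = h * δ / 4 := by
      rw [hR]; field_simp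
    have h7 : (2 * C * h + 4 * C * C) / R = C * (2 / R) * h + 2 * (C * (C * (2 / R))) := by
      ring
    have h8 : h * δ / (4 * (C * C)) ≤ V t - V (t + h) := by
      rw [div_le_iff₀ (by positivity)]
      nlinarith
    linarith [min_le_left (h * δ / (4 * (C * C))) (δ * h₁ / (2 * C))]

/-! ### Calculus of bounded signals. -/

/-- A real signal is bounded on `[0, ∞)`. -/
def BoundedScalar (f : ℝ → ℝ) : Prop := ∃ C : ℝ, ∀ t ≥ (0 : ℝ), |f t| ≤ C

namespace BoundedScalar

variable {f g : ℝ → ℝ}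

theorem const (c : ℝ) : BoundedScalar fun _ => c := ⟨|c|, fun _ _ => le_rfl⟩

theorem mono (hg : BoundedScalar g) (h : ∀ t ≥ (0 : ℝ), |f t| ≤ |g t|) : BoundedScalar f :=
  hg.imp fun _ hC t ht => (h t ht).trans (hC t ht)

theorem congr (hg : BoundedScalar g) (h : ∀ t ≥ (0 : ℝ), f t = g t) : BoundedScalar f :=
  hg.mono fun t ht => by rw [h t ht]

theorem add (hf : BoundedScalar f) (hg : BoundedScalar g) : BoundedScalar fun t => f t + g t := by
  obtain ⟨C, hC⟩ := hf
  obtain ⟨D, hD⟩ := hg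
  exact ⟨C + D, fun t ht => (abs_add_le _ _).trans (add_le_add (hC t ht) (hD t ht))⟩

theorem neg (hf : BoundedScalar f) : BoundedScalar fun t => -f t :=
  hf.imp fun _ hC t ht => by rw [abs_neg]; exact hC t ht

theorem sub (hf : BoundedScalar f) (hg : BoundedScalar g) : BoundedScalar fun t => f t - g t := by
  simpa only [sub_eq_add_neg] using hf.add hg.neg

theorem mul (hf : BoundedScalar f) (hg : BoundedScalar g) : BoundedScalar fun t => f t * g t := by
  obtain ⟨C, hC⟩ := hf
  obtain ⟨D, hD⟩ := hg
  refine ⟨C * D, fun t ht => ?_⟩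
  rw [abs_mul]
  exact mul_le_mul (hC t ht) (hD t ht) (abs_nonneg _) ((abs_nonneg _).trans (hC t ht))

theorem sum {α : Type*} (s : Finset α) {F : α → ℝ → ℝ} (hF : ∀ i ∈ s, BoundedScalar (F i)) :
    BoundedScalar fun t => ∑ i ∈ s, F i t := by
  classical
  induction s using Finset.induction_on with
  | empty => simpa using const 0
  | insert a s ha ih =>
    simp only [Finset.sum_insert ha]
    exact (hF a (Finset.mem_insert_self a s)).add
      (ih fun i hi => hF i (Finset.mem_insert_of_mem hi))

theorem of_sq (hf : BoundedScalar fun t => f t * f t) : BoundedScalar f := by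
  obtain ⟨C, hC⟩ := hf
  refine ⟨C + 1, fun t ht => ?_⟩
  have := hC t ht
  rw [abs_mul_self] at this
  rw [abs_le]
  constructor <;> nlinarith [sq_nonneg (f t - 1), sq_nonneg (f t + 1)]

theorem exists_pos (hf : BoundedScalar f) : ∃ C > (0 : ℝ), ∀ t ≥ (0 : ℝ), |f t| ≤ C := by
  obtain ⟨C, hC⟩ := hf
  exact ⟨max C 1, lt_max_of_lt_right one_pos, fun t ht => (hC t ht).trans (le_max_left _ _)⟩

end BoundedScalar

section Vectors

variable {ι κ : Type*} [Fintype ι] [Fintype κ]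

theorem boundedSignal_iff {f : ℝ → ι → ℝ} :
    BoundedSignal f ↔ ∀ i, BoundedScalar fun t => f t i := by
  constructor
  · rintro ⟨C, hC⟩ i
    exact ⟨C, fun t ht => (norm_le_pi_norm (f t) i).trans (hC t ht)⟩
  · intro h
    choose C hC using h
    refine ⟨∑ i, |C i|, fun t ht => ?_⟩
    rw [pi_norm_le_iff_of_nonneg (Finset.sum_nonneg fun i _ => abs_nonneg _)]
    intro i
    exact ((hC i t ht).trans (le_abs_self _)).trans
      (Finset.single_le_sum (f := fun i => |C i|) (fun _ _ => abs_nonneg _) (Finset.mem_univ i))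

theorem boundedMatrixSignal_iff {M : ℝ → Matrix ι κ ℝ} :
    BoundedMatrixSignal M ↔ ∀ a b, BoundedScalar fun t => M t a b := by
  constructor
  · rintro ⟨C, hC⟩ a b
    exact ⟨C, fun t ht => hC t ht a b⟩
  · intro h
    choose C hC using h
    refine ⟨∑ a, ∑ b, |C a b|, fun t ht a b => ?_⟩
    refine ((hC a b t ht).trans (le_abs_self _)).trans ?_
    refine (Finset.single_le_sum (f := fun b => |C a b|) (fun _ _ => abs_nonneg _)
      (Finset.mem_univ b)).trans ?_
    exact Finset.single_le_sum (f := fun a => ∑ b, |C a b|)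
      (fun _ _ => Finset.sum_nonneg fun _ _ => abs_nonneg _) (Finset.mem_univ a)

theorem BoundedMatrixSignal.const (M : Matrix ι κ ℝ) : BoundedMatrixSignal fun _ => M :=
  boundedMatrixSignal_iff.2 fun _ _ => .const _

theorem BoundedMatrixSignal.add {M L : ℝ → Matrix ι κ ℝ} (hM : BoundedMatrixSignal M)
    (hL : BoundedMatrixSignal L) : BoundedMatrixSignal fun t => M t + L t :=
  boundedMatrixSignal_iff.2 fun a b =>
    (boundedMatrixSignal_iff.1 hM a b).add (boundedMatrixSignal_iff.1 hL a b)

theorem BoundedMatrixSignal.sub {M L : ℝ → Matrix ι κ ℝ} (hM : BoundedMatrixSignal M)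
    (hL : BoundedMatrixSignal L) : BoundedMatrixSignal fun t => M t - L t :=
  boundedMatrixSignal_iff.2 fun a b =>
    (boundedMatrixSignal_iff.1 hM a b).sub (boundedMatrixSignal_iff.1 hL a b)

theorem BoundedMatrixSignal.const_mul {μ : Type*} [Fintype μ] (A : Matrix μ ι ℝ)
    {M : ℝ → Matrix ι κ ℝ} (hM : BoundedMatrixSignal M) :
    BoundedMatrixSignal fun t => A * M t :=
  boundedMatrixSignal_iff.2 fun _ b => .sum _ fun i _ =>
    (BoundedScalar.const _).mul (boundedMatrixSignal_iff.1 hM i b)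

namespace BoundedSignal

variable {f g : ℝ → ι → ℝ}

theorem add (hf : BoundedSignal f) (hg : BoundedSignal g) : BoundedSignal fun t => f t + g t :=
  boundedSignal_iff.2 fun i => (boundedSignal_iff.1 hf i).add (boundedSignal_iff.1 hg i)

theorem sub (hf : BoundedSignal f) (hg : BoundedSignal g) : BoundedSignal fun t => f t - g t :=
  boundedSignal_iff.2 fun i => (boundedSignal_iff.1 hf i).sub (boundedSignal_iff.1 hg i)

theorem smul {c : ℝ → ℝ} (hc : BoundedScalar c) (hf : BoundedSignal f) :
    BoundedSignal fun t => c t • f t :=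
  boundedSignal_iff.2 fun i => hc.mul (boundedSignal_iff.1 hf i)

theorem congr (hg : BoundedSignal g) (h : ∀ t ≥ (0 : ℝ), f t = g t) : BoundedSignal f :=
  boundedSignal_iff.2 fun i => (boundedSignal_iff.1 hg i).congr fun t ht => by rw [h t ht]

theorem dotProduct (hf : BoundedSignal f) (hg : BoundedSignal g) :
    BoundedScalar fun t => f t ⬝ᵥ g t :=
  .sum _ fun i _ => (boundedSignal_iff.1 hf i).mul (boundedSignal_iff.1 hg i)

theorem mulVec {M : ℝ → Matrix κ ι ℝ} (hM : BoundedMatrixSignal M) (hf : BoundedSignal f) :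
    BoundedSignal fun t => M t *ᵥ f t :=
  boundedSignal_iff.2 fun k => .sum _ fun i _ =>
    (boundedMatrixSignal_iff.1 hM k i).mul (boundedSignal_iff.1 hf i)

theorem const_mulVec (M : Matrix κ ι ℝ) (hf : BoundedSignal f) :
    BoundedSignal fun t => M *ᵥ f t :=
  mulVec (.const M) hf

end BoundedSignal

/-! ### Differentiation of products and comparison of quadratic forms. -/

variable {f g : ℝ → ι → ℝ} {f' g' : ι → ℝ} {s : Set ℝ} {t : ℝ}

theorem _root_.HasDerivWithinAt.dotProduct (hf : HasDerivWithinAt f f' s t)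
    (hg : HasDerivWithinAt g g' s t) :
    HasDerivWithinAt (fun τ => f τ ⬝ᵥ g τ) (f' ⬝ᵥ g t + f t ⬝ᵥ g') s t := by
  have h := HasDerivWithinAt.fun_sum (u := Finset.univ) fun i _ =>
    (hasDerivWithinAt_pi.1 hf i).mul (hasDerivWithinAt_pi.1 hg i)
  rw [Finset.sum_add_distrib] at h
  exact h

theorem _root_.HasDerivWithinAt.matrix_mulVec {κ : Type*} {M : ℝ → Matrix κ ι ℝ} {M' : Matrix κ ι ℝ}
    (hM : ∀ a b, HasDerivWithinAt (fun τ => M τ a b) (M' a b) s t)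
    (hf : HasDerivWithinAt f f' s t) :
    HasDerivWithinAt (fun τ => M τ *ᵥ f τ) (M' *ᵥ f t + M t *ᵥ f') s t :=
  hasDerivWithinAt_pi.2 fun a => (hasDerivWithinAt_pi.2 fun b => hM a b).dotProduct hf

theorem _root_.HasDerivWithinAt.const_mulVec {κ : Type*} (M : Matrix κ ι ℝ) (hf : HasDerivWithinAt f f' s t) :
    HasDerivWithinAt (fun τ => M *ᵥ f τ) (M *ᵥ f') s t := by
  simpa using HasDerivWithinAt.matrix_mulVec (M := fun _ => M) (M' := 0)
    (fun a b => hasDerivWithinAt_const t s (M a b)) hf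

/-- The bilinear form of a symmetric matrix is symmetric. -/
theorem dotProduct_mulVec_comm_of_transpose_eq {M : Matrix ι ι ℝ} (hM : Mᵀ = M) (v w : ι → ℝ) :
    v ⬝ᵥ M *ᵥ w = w ⬝ᵥ M *ᵥ v := by
  rw [Matrix.dotProduct_mulVec, ← Matrix.mulVec_transpose, hM, dotProduct_comm]

theorem _root_.HasDerivWithinAt.quadratic {M : Matrix ι ι ℝ} (hM : Mᵀ = M)
    (hf : HasDerivWithinAt f f' s t) :
    HasDerivWithinAt (fun τ => f τ ⬝ᵥ M *ᵥ f τ) (2 * (f t ⬝ᵥ M *ᵥ f')) s t := by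
  have h := hf.dotProduct (hf.const_mulVec M)
  rwa [dotProduct_mulVec_comm_of_transpose_eq hM, ← two_mul] at h

theorem posDef_transpose_eq {ι : Type*} {M : Matrix ι ι ℝ} (hM : M.PosDef) : Mᵀ = M := by
  have := hM.isHermitian
  rwa [Matrix.IsHermitian, Matrix.conjTranspose_eq_transpose_of_trivial] at this

theorem posDef_dotProduct_nonneg {M : Matrix ι ι ℝ} (hM : M.PosDef) (v : ι → ℝ) :
    0 ≤ v ⬝ᵥ M *ᵥ v := by
  simpa using hM.posSemidef.dotProduct_mulVec_nonneg v

theorem posDef_of_forall_pos {M : Matrix ι ι ℝ} (hM : Mᵀ = M)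
    (h : ∀ v : ι → ℝ, v ≠ 0 → 0 < v ⬝ᵥ M *ᵥ v) : M.PosDef := by
  refine Matrix.PosDef.of_dotProduct_mulVec_pos ?_ fun {v} hv => by simpa using h v hv
  rwa [Matrix.IsHermitian, Matrix.conjTranspose_eq_transpose_of_trivial]

/-- Every quadratic form is dominated by a positive definite one. -/
theorem exists_abs_quadratic_le {Q : Matrix ι ι ℝ} (hQ : Q.PosDef) (M : Matrix ι ι ℝ) :
    ∃ C > (0 : ℝ), ∀ v : ι → ℝ, |v ⬝ᵥ M *ᵥ v| ≤ C * (v ⬝ᵥ Q *ᵥ v) := by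
  have hpos : ∀ v : ι → ℝ, v ≠ 0 → 0 < v ⬝ᵥ Q *ᵥ v := fun v hv => by
    simpa using hQ.dotProduct_mulVec_pos hv
  have hcont : ∀ L : Matrix ι ι ℝ, Continuous fun v : ι → ℝ => v ⬝ᵥ L *ᵥ v := fun L => by
    simp only [dotProduct, Matrix.mulVec]
    fun_prop
  -- The quotient of the two forms is homogeneous of degree `0`, so a bound on the compact unit
  -- sphere suffices.
  obtain ⟨C, hC⟩ := (isCompact_sphere (0 : ι → ℝ) 1).exists_bound_of_continuousOn
    (f := fun v => (v ⬝ᵥ M *ᵥ v) / (v ⬝ᵥ Q *ᵥ v))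
    ((hcont M).continuousOn.div (hcont Q).continuousOn fun v hv =>
      (hpos v (ne_zero_of_mem_unit_sphere ⟨v, hv⟩)).ne')
  refine ⟨max C 1, lt_max_of_lt_right one_pos, fun v => ?_⟩
  rcases eq_or_ne v 0 with rfl | hv
  · simp
  have hn : 0 < ‖v‖ := norm_pos_iff.2 hv
  have hu := hC (‖v‖⁻¹ • v) (by simp [norm_smul, hn.ne'])
  simp only [Matrix.mulVec_smul, smul_dotProduct, dotProduct_smul, smul_eq_mul] at hu
  rw [mul_div_mul_left _ _ (inv_ne_zero hn.ne'), mul_div_mul_left _ _ (inv_ne_zero hn.ne'),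
    Real.norm_eq_abs, abs_div, abs_of_pos (hpos v hv), div_le_iff₀ (hpos v hv)] at hu
  exact hu.trans (mul_le_mul_of_nonneg_right (le_max_left _ _) (hpos v hv).le)

/-- A signal is bounded when a positive definite quadratic form of it is. -/
theorem boundedSignal_of_quadratic {Q : Matrix ι ι ℝ} (hQ : Q.PosDef) {f : ℝ → ι → ℝ}
    (hf : BoundedScalar fun t => f t ⬝ᵥ Q *ᵥ f t) : BoundedSignal f := by
  classical
  obtain ⟨C, hC, hle⟩ := exists_abs_quadratic_le hQ 1
  refine boundedSignal_iff.2 fun i => .of_sq (((BoundedScalar.const C).mul hf).mono fun t _ => ?_)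
  have h0 := posDef_dotProduct_nonneg hQ (f t)
  rw [abs_mul_self, abs_of_nonneg (mul_nonneg hC.le h0)]
  refine le_trans ?_ (hle (f t))
  rw [Matrix.one_mulVec]
  refine le_trans ?_ (le_abs_self _)
  exact Finset.single_le_sum (f := fun i => f t i * f t i) (fun _ _ => mul_self_nonneg _)
    (Finset.mem_univ i)

end Vectors

section Identities

variable {ι : Type*} [Fintype ι]

theorem dotProduct_transpose_mulVec (B : Matrix ι ι ℝ) (v w : ι → ℝ) :
    v ⬝ᵥ Bᵀ *ᵥ w = (B *ᵥ v) ⬝ᵥ w := by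
  rw [Matrix.dotProduct_mulVec, Matrix.vecMul_transpose]

theorem adaptiveLaw_apply {κ : Type*} (A : Matrix ι ι ℝ) (e : ι → ℝ) (v : κ → ℝ) (a : ι) (b : κ) :
    (-(A * Matrix.vecMulVec e v)) a b = -(v b * (A *ᵥ e) a) := by
  rw [Matrix.mul_vecMulVec, Matrix.neg_apply, Matrix.vecMulVec_apply, mul_comm]

theorem adaptiveLaw_mulVec {κ : Type*} [Fintype κ] (A : Matrix ι ι ℝ) (e : ι → ℝ) (v w : κ → ℝ) :
    (-(A * Matrix.vecMulVec e v)) *ᵥ w = -((v ⬝ᵥ w) • (A *ᵥ e)) := by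
  rw [Matrix.mul_vecMulVec, Matrix.neg_mulVec, Matrix.vecMulVec_mulVec]
  simp

end Identities

/-! ### Parameter energy and the Lyapunov argument. -/

section Energy

variable {ι κ : Type*} [Fintype ι] [Fintype κ] [DecidableEq ι]

/-- The weighted Frobenius energy `tr(Θᵀ Γ⁻¹ Θ)` of a parameter error. -/
noncomputable def paramEnergy (Γ : Matrix ι ι ℝ) (Θ : Matrix ι κ ℝ) : ℝ :=
  ∑ b, (fun a => Θ a b) ⬝ᵥ Γ⁻¹ *ᵥ fun a => Θ a b

theorem paramEnergy_nonneg {Γ : Matrix ι ι ℝ} (hΓ : Γ.PosDef) (Θ : Matrix ι κ ℝ) :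
    0 ≤ paramEnergy Γ Θ :=
  Finset.sum_nonneg fun _ _ => posDef_dotProduct_nonneg hΓ.inv _

theorem boundedMatrixSignal_of_paramEnergy {Γ : Matrix ι ι ℝ} (hΓ : Γ.PosDef)
    {Θ : ℝ → Matrix ι κ ℝ} (h : BoundedScalar fun t => paramEnergy Γ (Θ t)) :
    BoundedMatrixSignal Θ := by
  refine boundedMatrixSignal_iff.2 fun a b => ?_
  suffices hb : BoundedSignal fun t a => Θ t a b from boundedSignal_iff.1 hb a
  refine boundedSignal_of_quadratic hΓ.inv (h.mono fun t _ => ?_)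
  rw [abs_of_nonneg (posDef_dotProduct_nonneg hΓ.inv _), abs_of_nonneg (paramEnergy_nonneg hΓ _)]
  exact Finset.single_le_sum (f := fun b => (fun a => Θ t a b) ⬝ᵥ Γ⁻¹ *ᵥ fun a => Θ t a b)
    (fun _ _ => posDef_dotProduct_nonneg hΓ.inv _) (Finset.mem_univ b)

theorem dotProduct_inv_mulVec_mulVec {Γ : Matrix ι ι ℝ} (hΓ : Γ.PosDef) (v w : ι → ℝ) :
    v ⬝ᵥ Γ⁻¹ *ᵥ (Γ *ᵥ w) = v ⬝ᵥ w := by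
  rw [Matrix.mulVec_mulVec,
    Matrix.nonsing_inv_mul Γ ((Matrix.isUnit_iff_isUnit_det Γ).1 hΓ.isUnit), Matrix.one_mulVec]

/-- Along the gradient law, the parameter energy exchanges exactly the cross term of the error
energy. -/
theorem hasDerivWithinAt_paramEnergy {Γ B P : Matrix ι ι ℝ} (hΓ : Γ.PosDef)
    {Θ : ℝ → Matrix ι κ ℝ} {e : ι → ℝ} {v : κ → ℝ} {s : Set ℝ} {t : ℝ}
    (hΘ : ∀ a b, HasDerivWithinAt (fun τ => Θ τ a b)
      ((-(Γ * Bᵀ * P * Matrix.vecMulVec e v)) a b) s t) :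
    HasDerivWithinAt (fun τ => paramEnergy Γ (Θ τ))
      (-(2 * ((B *ᵥ (Θ t *ᵥ v)) ⬝ᵥ P *ᵥ e))) s t := by
  have hcol : ∀ b, HasDerivWithinAt (fun τ a => Θ τ a b)
      (-(v b • (Γ *ᵥ (Bᵀ *ᵥ (P *ᵥ e))))) s t := fun b => by
    refine hasDerivWithinAt_pi.2 fun a => ?_
    have := hΘ a b
    rw [adaptiveLaw_apply] at this
    simpa [Matrix.mulVec_mulVec, Matrix.mul_assoc] using this
  have h := HasDerivWithinAt.fun_sum (u := Finset.univ) fun b _ =>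
    (hcol b).quadratic (posDef_transpose_eq hΓ.inv)
  refine h.congr_deriv ?_
  simp only [Matrix.mulVec_neg, Matrix.mulVec_smul, dotProduct_neg, dotProduct_smul,
    dotProduct_inv_mulVec_mulVec hΓ, dotProduct_transpose_mulVec, smul_eq_mul]
  have hsum : Θ t *ᵥ v = ∑ b, v b • fun a => Θ t a b := by
    ext a
    simp [Matrix.mulVec, dotProduct, mul_comm]
  rw [hsum, Matrix.mulVec_sum, sum_dotProduct, Finset.mul_sum, ← Finset.sum_neg_distrib]
  refine Finset.sum_congr rfl fun b _ => ?_
  rw [Matrix.mulVec_smul, smul_dotProduct, smul_eq_mul]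
  ring

end Energy

section ErrorSystem

variable {ι κ : Type*} [Fintype ι] [Fintype κ] [DecidableEq ι]

/-- The error system of the adaptive network: a Lyapunov-stable error driven by two gradient-adapted
parameter errors. -/
structure IsErrorSystem (A B P Q Γφ Γψ : Matrix ι ι ℝ) (e z : ℝ → ι → ℝ) (v : ℝ → κ → ℝ)
    (Φ : ℝ → Matrix ι ι ℝ) (Ψ : ℝ → Matrix ι κ ℝ) : Prop where
  posDef_P : P.PosDef
  posDef_Q : Q.PosDef
  posDef_Γφ : Γφ.PosDef
  posDef_Γψ : Γψ.PosDef
  lyapunov : Aᵀ * P + P * A = -Q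
  error : ∀ t ≥ (0 : ℝ), HasDerivWithinAt e
    (A *ᵥ e t + B *ᵥ (Φ t *ᵥ z t) + B *ᵥ (Ψ t *ᵥ v t)) (Set.Ici 0) t
  lawΦ : ∀ t ≥ (0 : ℝ), ∀ a b, HasDerivWithinAt (fun s => Φ s a b)
    ((-(Γφ * Bᵀ * P * Matrix.vecMulVec (e t) (z t))) a b) (Set.Ici 0) t
  lawΨ : ∀ t ≥ (0 : ℝ), ∀ a b, HasDerivWithinAt (fun s => Ψ s a b)
    ((-(Γψ * Bᵀ * P * Matrix.vecMulVec (e t) (v t))) a b) (Set.Ici 0) t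

namespace IsErrorSystem

variable {A B P Q Γφ Γψ : Matrix ι ι ℝ} {e z : ℝ → ι → ℝ} {v : ℝ → κ → ℝ}
  {Φ : ℝ → Matrix ι ι ℝ} {Ψ : ℝ → Matrix ι κ ℝ}

theorem two_mul_dotProduct_mulVec (h : IsErrorSystem A B P Q Γφ Γψ e z v Φ Ψ) (w : ι → ℝ) :
    2 * (w ⬝ᵥ P *ᵥ (A *ᵥ w)) = -(w ⬝ᵥ Q *ᵥ w) := by
  have h1 : w ⬝ᵥ (Aᵀ * P + P * A) *ᵥ w = w ⬝ᵥ (-Q) *ᵥ w := by rw [h.lyapunov]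
  rw [Matrix.add_mulVec, dotProduct_add, ← Matrix.mulVec_mulVec, ← Matrix.mulVec_mulVec,
    dotProduct_transpose_mulVec, Matrix.neg_mulVec, dotProduct_neg,
    dotProduct_mulVec_comm_of_transpose_eq (posDef_transpose_eq h.posDef_P)] at h1
  linarith

/-- The indefinite cross terms of the error energy are exactly those given up by the parameter
energies, whatever `z` and `v` are; only the Lyapunov equation remains. -/
theorem hasDerivWithinAt_energy (h : IsErrorSystem A B P Q Γφ Γψ e z v Φ Ψ) {t : ℝ} (ht : 0 ≤ t) :
    HasDerivWithinAt
      (fun s => e s ⬝ᵥ P *ᵥ e s + paramEnergy Γφ (Φ s) + paramEnergy Γψ (Ψ s))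
      (-(e t ⬝ᵥ Q *ᵥ e t)) (Set.Ici 0) t := by
  have hP := posDef_transpose_eq h.posDef_P
  refine ((((h.error t ht).quadratic hP).add
    (hasDerivWithinAt_paramEnergy h.posDef_Γφ (h.lawΦ t ht))).add
    (hasDerivWithinAt_paramEnergy h.posDef_Γψ (h.lawΨ t ht))).congr_deriv ?_
  rw [Matrix.mulVec_add, Matrix.mulVec_add, dotProduct_add, dotProduct_add,
    ← h.two_mul_dotProduct_mulVec,
    dotProduct_mulVec_comm_of_transpose_eq hP (B *ᵥ (Φ t *ᵥ z t)),
    dotProduct_mulVec_comm_of_transpose_eq hP (B *ᵥ (Ψ t *ᵥ v t))]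
  ring

/-- The energy is nonincreasing and is a sum of three nonnegative terms, so each stays below its
initial value. -/
theorem bounded (h : IsErrorSystem A B P Q Γφ Γψ e z v Φ Ψ) :
    BoundedSignal e ∧ BoundedMatrixSignal Φ ∧ BoundedMatrixSignal Ψ := by
  set V : ℝ → ℝ :=
    fun s => e s ⬝ᵥ P *ᵥ e s + paramEnergy Γφ (Φ s) + paramEnergy Γψ (Ψ s) with hV
  have hle : ∀ t ≥ (0 : ℝ), V t ≤ V 0 := fun t ht => by
    have := le_of_hasDerivWithinAt_Ici_nonneg (f := fun s => -V s)
      (f' := fun s => -(-(e s ⬝ᵥ Q *ᵥ e s)))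
      (fun s hs => (h.hasDerivWithinAt_energy hs).neg) le_rfl ht
      (fun s _ => by rw [neg_neg]; exact posDef_dotProduct_nonneg h.posDef_Q _)
    linarith
  have h1 : ∀ t, 0 ≤ e t ⬝ᵥ P *ᵥ e t := fun t => posDef_dotProduct_nonneg h.posDef_P _
  have h2 : ∀ t, 0 ≤ paramEnergy Γφ (Φ t) := fun t => paramEnergy_nonneg h.posDef_Γφ _
  have h3 : ∀ t, 0 ≤ paramEnergy Γψ (Ψ t) := fun t => paramEnergy_nonneg h.posDef_Γψ _
  simp only [hV] at hle
  refine ⟨boundedSignal_of_quadratic h.posDef_P ⟨V 0, fun t ht => ?_⟩,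
    boundedMatrixSignal_of_paramEnergy h.posDef_Γφ ⟨V 0, fun t ht => ?_⟩,
    boundedMatrixSignal_of_paramEnergy h.posDef_Γψ ⟨V 0, fun t ht => ?_⟩⟩
  · rw [abs_of_nonneg (h1 t)]; linarith [hle t ht, h2 t, h3 t]
  · rw [abs_of_nonneg (h2 t)]; linarith [hle t ht, h1 t, h3 t]
  · rw [abs_of_nonneg (h3 t)]; linarith [hle t ht, h1 t, h2 t]

end IsErrorSystem

end ErrorSystem

/-! ### Normalization of the growing regressor. -/

section Normalization

variable {ι : Type*} [Fintype ι]

/-- The regularized length `√(1 + |z|²)`. -/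
noncomputable def regLength (z : ι → ℝ) : ℝ := √(1 + z ⬝ᵥ z)

/-- A vector divided by its regularized length. -/
noncomputable def normalized (z : ι → ℝ) : ι → ℝ := (regLength z)⁻¹ • z

theorem one_le_regLength (z : ι → ℝ) : 1 ≤ regLength z :=
  Real.one_le_sqrt.2 (le_add_of_nonneg_right (Finset.sum_nonneg fun _ _ => mul_self_nonneg _))

theorem regLength_pos (z : ι → ℝ) : 0 < regLength z := one_pos.trans_le (one_le_regLength z)

theorem regLength_mul_self (z : ι → ℝ) : regLength z * regLength z = 1 + z ⬝ᵥ z :=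
  Real.mul_self_sqrt (add_nonneg zero_le_one (Finset.sum_nonneg fun _ _ => mul_self_nonneg _))

theorem regLength_smul_normalized (z : ι → ℝ) : regLength z • normalized z = z := by
  rw [normalized, smul_smul, mul_inv_cancel₀ (regLength_pos z).ne', one_smul]

/-- Splits the derivative of `Φ ζ` into a part of speed `ρ` and a remainder with the bounded factor
`ρ⁻¹`. -/
theorem dotProduct_normalized (z : ι → ℝ) :
    z ⬝ᵥ normalized z = regLength z - (regLength z)⁻¹ := by
  have h := regLength_mul_self z
  have hpos := regLength_pos z
  rw [normalized, dotProduct_smul, smul_eq_mul]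
  field_simp
  linarith

theorem boundedScalar_inv_regLength (z : ℝ → ι → ℝ) :
    BoundedScalar fun t => (regLength (z t))⁻¹ := by
  refine ⟨1, fun t _ => ?_⟩
  rw [abs_of_pos (inv_pos.2 (regLength_pos _))]
  exact inv_le_one_of_one_le₀ (one_le_regLength _)

theorem boundedSignal_normalized (z : ℝ → ι → ℝ) : BoundedSignal fun t => normalized (z t) := by
  refine boundedSignal_iff.2 fun i => .of_sq ⟨1, fun t _ => ?_⟩
  have h := regLength_mul_self (z t)
  have hpos := regLength_pos (z t)
  have hle : z t i * z t i ≤ z t ⬝ᵥ z t :=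
    Finset.single_le_sum (f := fun i => z t i * z t i) (fun _ _ => mul_self_nonneg _)
      (Finset.mem_univ i)
  rw [abs_mul_self, normalized, Pi.smul_apply, smul_eq_mul, mul_mul_mul_comm, ← mul_inv,
    inv_mul_le_iff₀ (mul_pos hpos hpos)]
  linarith

variable {z : ℝ → ι → ℝ} {z' : ι → ℝ} {s : Set ℝ} {t : ℝ}

theorem hasDerivWithinAt_regLength (hz : HasDerivWithinAt z z' s t) :
    HasDerivWithinAt (fun τ => regLength (z τ)) (normalized (z t) ⬝ᵥ z') s t := by
  have hpos := regLength_pos (z t)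
  have h := ((hz.dotProduct hz).const_add 1).sqrt (by
    rw [← regLength_mul_self]; exact (mul_pos hpos hpos).ne')
  refine h.congr_deriv ?_
  change _ / (2 * regLength (z t)) = _
  rw [normalized, smul_dotProduct, smul_eq_mul, dotProduct_comm z']
  field_simp
  ring

/-- The velocity is kept in the combination `ρ⁻¹ z'`, which stays bounded when `z' = D z + d` with
bounded `D` and `d`. -/
theorem hasDerivWithinAt_inv_regLength (hz : HasDerivWithinAt z z' s t) :
    HasDerivWithinAt (fun τ => (regLength (z τ))⁻¹)
      (-((regLength (z t))⁻¹ * (normalized (z t) ⬝ᵥ ((regLength (z t))⁻¹ • z')))) s t := by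
  have hpos := regLength_pos (z t)
  refine ((hasDerivWithinAt_regLength hz).fun_inv hpos.ne').congr_deriv ?_
  rw [dotProduct_smul, smul_eq_mul]
  field_simp

theorem hasDerivWithinAt_normalized (hz : HasDerivWithinAt z z' s t) :
    HasDerivWithinAt (fun τ => normalized (z τ))
      ((regLength (z t))⁻¹ • z'
        - (normalized (z t) ⬝ᵥ ((regLength (z t))⁻¹ • z')) • normalized (z t)) s t := by
  refine ((hasDerivWithinAt_inv_regLength hz).fun_smul hz).congr_deriv ?_
  ext i
  simp only [normalized, Pi.add_apply, Pi.sub_apply, Pi.smul_apply, smul_eq_mul]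
  ring

end Normalization

/-! ### Convergence of the error under a possibly unbounded regressor. -/

namespace IsErrorSystem

variable {ι κ : Type*} [Fintype ι] [Fintype κ] [DecidableEq ι]
  {A B P Q Γφ Γψ : Matrix ι ι ℝ} {e z : ℝ → ι → ℝ} {v : ℝ → κ → ℝ}
  {Φ : ℝ → Matrix ι ι ℝ} {Ψ : ℝ → Matrix ι κ ℝ}

/-- The error vanishes asymptotically even though the regressor `z` may grow exponentially. -/
theorem tendsto_zero (h : IsErrorSystem A B P Q Γφ Γψ e z v Φ Ψ)
    (hB : ∀ w : ι → ℝ, B *ᵥ w = 0 → w = 0) (hv : BoundedSignal v)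
    {D : ℝ → Matrix ι ι ℝ} {d : ℝ → ι → ℝ} (hD : BoundedMatrixSignal D) (hd : BoundedSignal d)
    (hz : ∀ t ≥ (0 : ℝ), HasDerivWithinAt z (D t *ᵥ z t + d t) (Set.Ici 0) t) :
    Filter.Tendsto e Filter.atTop (𝓝 0) := by
  obtain ⟨he, hΦ, hΨ⟩ := h.bounded
  have hP := posDef_transpose_eq h.posDef_P
  have hΓ := posDef_transpose_eq h.posDef_Γφ.inv
  set ρ : ℝ → ℝ := fun t => regLength (z t) with hρdef
  set ζ : ℝ → ι → ℝ := fun t => normalized (z t) with hζdef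
  set σ : ℝ → ι → ℝ := fun t => Φ t *ᵥ ζ t with hσdef
  set β : ℝ → ι → ℝ := fun t => A *ᵥ e t + B *ᵥ (Ψ t *ᵥ v t) with hβdef
  set ξ : ℝ → ι → ℝ := fun t => D t *ᵥ ζ t + (ρ t)⁻¹ • d t with hξdef
  set l : ℝ → ℝ := fun t => ζ t ⬝ᵥ ξ t with hldef
  set U : Matrix ι ι ℝ := Γφ * Bᵀ * P with hUdef
  set γ : ℝ → ι → ℝ := fun t => (ρ t)⁻¹ • (U *ᵥ e t) + Φ t *ᵥ (ξ t - l t • ζ t) with hγdef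
  have hρpos : ∀ t, 0 < ρ t := fun t => regLength_pos _
  have hr : BoundedScalar fun t => (ρ t)⁻¹ := boundedScalar_inv_regLength z
  have hζ : BoundedSignal ζ := boundedSignal_normalized z
  have hσ : BoundedSignal σ := hζ.mulVec hΦ
  have hβ : BoundedSignal β := (he.const_mulVec A).add ((hv.mulVec hΨ).const_mulVec B)
  have hξ : BoundedSignal ξ := (hζ.mulVec hD).add (hd.smul hr)
  have hl : BoundedScalar l := hζ.dotProduct hξ
  have hγ : BoundedSignal γ :=
    ((he.const_mulVec U).smul hr).add ((hξ.sub (hζ.smul hl)).mulVec hΦ)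
  have hξz : ∀ t, (ρ t)⁻¹ • (D t *ᵥ z t + d t) = ξ t := fun t => by
    simp only [hξdef, hζdef, normalized, Matrix.mulVec_smul, smul_add, hρdef]
  have hσz : ∀ t, Φ t *ᵥ z t = ρ t • σ t := fun t => by
    simp only [hσdef, hζdef, hρdef]
    rw [← Matrix.mulVec_smul, regLength_smul_normalized]
  have de : ∀ t ≥ (0 : ℝ), HasDerivWithinAt e (ρ t • (B *ᵥ σ t) + β t) (Set.Ici 0) t :=
    fun t ht => (h.error t ht).congr_deriv (by
      rw [hσz, Matrix.mulVec_smul]; simp only [hβdef]; abel)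
  have dρ : ∀ t ≥ (0 : ℝ), HasDerivWithinAt ρ (ρ t * l t) (Set.Ici 0) t := fun t ht =>
    (hasDerivWithinAt_regLength (hz t ht)).congr_deriv (by
      simp only [hldef]
      rw [← hξz, dotProduct_smul, smul_eq_mul, mul_inv_cancel_left₀ (hρpos t).ne'])
  have dr : ∀ t ≥ (0 : ℝ), HasDerivWithinAt (fun t => (ρ t)⁻¹) (-((ρ t)⁻¹ * l t))
      (Set.Ici 0) t := fun t ht =>
    (hasDerivWithinAt_inv_regLength (hz t ht)).congr_deriv (by
      simp only [hldef]; rw [← hξz])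
  have dζ : ∀ t ≥ (0 : ℝ), HasDerivWithinAt ζ (ξ t - l t • ζ t) (Set.Ici 0) t := fun t ht =>
    (hasDerivWithinAt_normalized (hz t ht)).congr_deriv (by
      simp only [hldef]; rw [← hξz])
  -- The rank-one law applied to `ζ` produces `-(z · ζ) U e` with `z · ζ = ρ - ρ⁻¹`; the `ρ⁻¹` part
  -- is absorbed in `γ`.
  have dσ : ∀ t ≥ (0 : ℝ), HasDerivWithinAt σ (-(ρ t • (U *ᵥ e t)) + γ t) (Set.Ici 0) t :=
    fun t ht => (HasDerivWithinAt.matrix_mulVec (h.lawΦ t ht) (dζ t ht)).congr_deriv (by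
      simp only [hγdef, hζdef, hρdef]
      rw [adaptiveLaw_mulVec, dotProduct_normalized, sub_smul]
      abel)
  have dy : ∀ t ≥ (0 : ℝ), HasDerivWithinAt (fun t => e t ⬝ᵥ P *ᵥ e t)
      (2 * (e t ⬝ᵥ P *ᵥ (ρ t • (B *ᵥ σ t) + β t))) (Set.Ici 0) t :=
    fun t ht => (de t ht).quadratic hP
  -- The weight `Γφ⁻¹` makes the two terms of order `ρ` cancel, so this derivative is bounded
  -- however large `z` is.
  have dW : ∀ t ≥ (0 : ℝ), HasDerivWithinAt
      (fun t => e t ⬝ᵥ P *ᵥ e t + σ t ⬝ᵥ Γφ⁻¹ *ᵥ σ t)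
      (2 * (e t ⬝ᵥ P *ᵥ β t) + 2 * (σ t ⬝ᵥ Γφ⁻¹ *ᵥ γ t)) (Set.Ici 0) t :=
    fun t ht => ((dy t ht).fun_add ((dσ t ht).quadratic hΓ)).congr_deriv (by
      have h1 : σ t ⬝ᵥ Γφ⁻¹ *ᵥ (U *ᵥ e t) = e t ⬝ᵥ P *ᵥ (B *ᵥ σ t) := by
        rw [hUdef, Matrix.mul_assoc, ← Matrix.mulVec_mulVec,
          dotProduct_inv_mulVec_mulVec h.posDef_Γφ, ← Matrix.mulVec_mulVec,
          dotProduct_transpose_mulVec, dotProduct_mulVec_comm_of_transpose_eq hP]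
      simp only [Matrix.mulVec_add, Matrix.mulVec_smul, Matrix.mulVec_neg, dotProduct_add,
        dotProduct_smul, dotProduct_neg, smul_eq_mul, h1]
      ring)
  set ε : ℝ → ℝ := fun t => -(l t * (e t ⬝ᵥ B *ᵥ σ t)) + β t ⬝ᵥ B *ᵥ σ t + e t ⬝ᵥ B *ᵥ γ t
    with hεdef
  have hε : BoundedScalar ε :=
    ((hl.mul (he.dotProduct (hσ.const_mulVec B))).neg.add (hβ.dotProduct (hσ.const_mulVec B))).add
      (he.dotProduct (hγ.const_mulVec B))
  -- The factor `ρ⁻¹` cancels the speed of the exchange: `e'` contributes `|B σ|²`, `σ'` contributes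
  -- a quadratic form in `e`, and the rest is `O(ρ⁻¹)`.
  have dχ : ∀ t ≥ (0 : ℝ), HasDerivWithinAt (fun t => (ρ t)⁻¹ * (e t ⬝ᵥ B *ᵥ σ t))
      ((B *ᵥ σ t) ⬝ᵥ (B *ᵥ σ t) - e t ⬝ᵥ (B * U) *ᵥ e t + (ρ t)⁻¹ * ε t) (Set.Ici 0) t :=
    fun t ht => ((dr t ht).fun_mul ((de t ht).dotProduct ((dσ t ht).const_mulVec B))).congr_deriv
      (by
        have := (hρpos t).ne'
        simp only [hεdef, add_dotProduct, smul_dotProduct, Matrix.mulVec_add, Matrix.mulVec_smul,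
          Matrix.mulVec_neg, dotProduct_add, dotProduct_smul, dotProduct_neg, smul_eq_mul,
          ← Matrix.mulVec_mulVec]
        field_simp
        ring)
  obtain ⟨C₁, hC₁, hPQ⟩ := exists_abs_quadratic_le h.posDef_Q P
  -- Injectivity of `B` enters here: it lets `|B σ|²` control the whole of `σᵀ Γφ⁻¹ σ`.
  have hBB : (Bᵀ * B).PosDef := by
    refine posDef_of_forall_pos (by simp) fun w hw => ?_
    rw [← Matrix.mulVec_mulVec, dotProduct_transpose_mulVec]
    have h0 : 0 ≤ (B *ᵥ w) ⬝ᵥ (B *ᵥ w) := Finset.sum_nonneg fun _ _ => mul_self_nonneg _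
    exact h0.lt_of_ne' fun h1 => hw (hB w (dotProduct_self_eq_zero.1 h1))
  obtain ⟨C₂, hC₂, hΓB⟩ := exists_abs_quadratic_le hBB Γφ⁻¹
  obtain ⟨C₃, hC₃, hBU⟩ := exists_abs_quadratic_le h.posDef_P (B * U)
  obtain ⟨C₄, hC₄, hε'⟩ := hε.exists_pos
  obtain ⟨C₅, hC₅, hW'⟩ := (((BoundedScalar.const 2).mul (he.dotProduct (hβ.const_mulVec P))).add
    ((BoundedScalar.const 2).mul (hσ.dotProduct (hγ.const_mulVec Γφ⁻¹)))).exists_pos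
  obtain ⟨C₆, hC₆, hy'⟩ := ((BoundedScalar.const 2).mul (he.dotProduct
    (((hσ.const_mulVec B).add (hβ.smul hr)).const_mulVec P))).exists_pos
  obtain ⟨C₇, hC₇, hl'⟩ := hl.exists_pos
  obtain ⟨C₈, hC₈, hχ'⟩ := (he.dotProduct (hσ.const_mulVec B)).exists_pos
  -- One constant for all hypotheses of the averaging lemma. The summands `1 + C₂ * C₃` and `C₂ *
  -- C₄` come from `W ≤ y + C₂ |B σ|²` once `|B σ|²` is expressed through the derivative in `dχ`.
  set C : ℝ := 1 + C₁ + C₂ + C₂ * C₃ + C₂ * C₄ + C₅ + C₆ + C₇ + C₈ with hCdef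
  have h23 := mul_pos hC₂ hC₃
  have h24 := mul_pos hC₂ hC₄
  have hC : 0 < C := by positivity
  have hQ0 : ∀ t, 0 ≤ e t ⬝ᵥ Q *ᵥ e t := fun t => posDef_dotProduct_nonneg h.posDef_Q _
  have hy0 : ∀ t, 0 ≤ e t ⬝ᵥ P *ᵥ e t := fun t => posDef_dotProduct_nonneg h.posDef_P _
  have hσ0 : ∀ t, 0 ≤ σ t ⬝ᵥ Γφ⁻¹ *ᵥ σ t := fun t => posDef_dotProduct_nonneg h.posDef_Γφ.inv _
  have key : Filter.Tendsto (fun t => e t ⬝ᵥ P *ᵥ e t) Filter.atTop (𝓝 0) := by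
    refine tendsto_zero_of_averaged_dissipation hC (fun t ht => h.hasDerivWithinAt_energy ht) dy dW
      -- The scaling turns `C χ'` into `C₂` times the derivative in `dχ`, the exact multiple needed
      -- to bound `W`; a signed derivative admits no enlarged constant.
      (fun t ht => (dχ t ht).const_mul (C₂ / C)) dρ ?_ (fun t _ => hy0 t) ?_ ?_ ?_ ?_
      (fun t _ => one_le_regLength _) ?_ ?_ ?_
    · exact fun t _ => add_nonneg (add_nonneg (hy0 t) (paramEnergy_nonneg h.posDef_Γφ _))
        (paramEnergy_nonneg h.posDef_Γψ _)
    · intro t _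
      have h1 := (le_abs_self _).trans (hPQ (e t))
      have h2 : C₁ * (e t ⬝ᵥ Q *ᵥ e t) ≤ C * (e t ⬝ᵥ Q *ᵥ e t) :=
        mul_le_mul_of_nonneg_right (by linarith) (hQ0 t)
      linarith
    · exact fun t _ => le_add_of_nonneg_right (hσ0 t)
    · exact fun t ht => (hW' t ht).trans (by linarith)
    · intro t ht
      have h1 : ρ t • (B *ᵥ σ t) + β t = ρ t • (B *ᵥ σ t + (ρ t)⁻¹ • β t) := by
        rw [smul_add, smul_smul, mul_inv_cancel₀ (hρpos t).ne', one_smul]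
      rw [h1, Matrix.mulVec_smul, dotProduct_smul, smul_eq_mul, mul_left_comm, abs_mul,
        abs_of_pos (hρpos t), mul_comm]
      exact mul_le_mul_of_nonneg_right ((hy' t ht).trans (by linarith)) (hρpos t).le
    · intro t ht
      rw [abs_mul, abs_of_pos (hρpos t), mul_comm]
      exact mul_le_mul_of_nonneg_right ((hl' t ht).trans (by linarith)) (hρpos t).le
    · intro t ht
      have hr0 := inv_pos.2 (hρpos t)
      have h1 : C₂ / C ≤ 1 := (div_le_one hC).2 (by linarith)
      rw [abs_mul, abs_mul, abs_of_pos (div_pos hC₂ hC), abs_of_pos hr0, div_eq_mul_inv C,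
        mul_comm C]
      refine (mul_le_of_le_one_left (mul_nonneg hr0.le (abs_nonneg _)) h1).trans ?_
      exact mul_le_mul_of_nonneg_left ((hχ' t ht).trans (by linarith)) hr0.le
    · intro t ht
      have hr0 := inv_pos.2 (hρpos t)
      have h1 := (le_abs_self _).trans (hΓB (σ t))
      rw [← Matrix.mulVec_mulVec, dotProduct_transpose_mulVec] at h1
      have h2 := mul_le_mul_of_nonneg_left ((le_abs_self _).trans (hBU (e t))) hC₂.le
      have h3 : C₂ * -((ρ t)⁻¹ * ε t) ≤ C₂ * C₄ * (ρ t)⁻¹ := by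
        have := mul_le_mul_of_nonneg_left ((neg_le_abs _).trans (hε' t ht)) hr0.le
        nlinarith
      have h4 : (1 + C₂ * C₃) * (e t ⬝ᵥ P *ᵥ e t) ≤ C * (e t ⬝ᵥ P *ᵥ e t) :=
        mul_le_mul_of_nonneg_right (by linarith) (hy0 t)
      have h5 : C₂ * C₄ * (ρ t)⁻¹ ≤ C * (ρ t)⁻¹ :=
        mul_le_mul_of_nonneg_right (by linarith) hr0.le
      rw [mul_add, mul_add, ← mul_assoc, mul_div_cancel₀ _ hC.ne', one_div]
      linarith
  obtain ⟨c, _, hc⟩ := exists_abs_quadratic_le h.posDef_P (1 : Matrix ι ι ℝ)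
  refine tendsto_pi_nhds.2 fun i => ?_
  have hsq : Filter.Tendsto (fun t => e t i ^ 2) Filter.atTop (𝓝 0) := by
    refine squeeze_zero (fun t => sq_nonneg _) (fun t => ?_) (by simpa using key.const_mul c)
    refine le_trans ?_ ((le_abs_self _).trans (hc (e t)))
    rw [Matrix.one_mulVec, sq]
    exact Finset.single_le_sum (f := fun i => e t i * e t i) (fun _ _ => mul_self_nonneg _)
      (Finset.mem_univ i)
  have habs := hsq.sqrt
  simp only [Real.sqrt_sq_eq_abs, Real.sqrt_zero] at habs
  exact (tendsto_zero_iff_abs_tendsto_zero _).2 habs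

end IsErrorSystem

/-! ### Graph algebra and reduction of the network to the error system. -/

variable {m n p q r : ℕ}

namespace Network

variable (N : Network m)

theorem augLaplacian_eq_one_sub (hbal : N.Balanced) : N.augLaplacian = 1 - N.adjacency := by
  have h : N.degreeMatrix + N.sourceAdjacency = 1 := by
    rw [← hbal, degreeMatrix, sourceAdjacency, totalWeight, Matrix.diagonal_add]
  rw [augLaplacian, laplacian, ← h]
  abel

theorem row_sum_eq_one (hbal : N.Balanced) (i : Fin m) :
    ∑ j : Fin m, N.w i.succ j.succ + N.w i.succ 0 = 1 := by
  have h := congrFun (congrFun hbal i) i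
  rwa [totalWeight, Matrix.diagonal_apply_eq, Matrix.one_apply_eq] at h

/-- Maximum principle: a fixed vector of the adjacency matrix of a balanced network vanishes when
the source reaches every node. -/
theorem eq_zero_of_adjacency_fixed (hbal : N.Balanced) (hreach : N.SourceReachable)
    {u : Fin m → ℝ} (hu : ∀ i, u i = ∑ j, N.w i.succ j.succ * u j) : u = 0 := by
  by_contra hne
  have hpos : 0 < ‖u‖ := norm_pos_iff.2 hne
  have hle : ∀ j, |u j| ≤ ‖u‖ := fun j => norm_le_pi_norm u j
  -- Extending `u` by `0` at the source starts the strict inequality there. It propagates along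
  -- edges because each `u i` is a convex combination of its neighbours' values, the source
  -- included, and one positively weighted neighbour lies strictly below the maximum.
  have hlt : ∀ k : Fin (m + 1), Relation.ReflTransGen (fun a b => 0 < N.w b a) 0 k →
      |(Fin.cons 0 u : Fin (m + 1) → ℝ) k| < ‖u‖ := by
    intro k hk
    induction hk with
    | refl => simpa using hpos
    | @tail a b _ hab ih =>
      refine Fin.cases (fun _ => by simpa using hpos) (fun i hab => ?_) b hab
      rw [Fin.cons_succ]
      have h1 : |u i| ≤ ∑ j, N.w i.succ j.succ * |u j| := by
        conv_lhs => rw [hu i]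
        refine (Finset.abs_sum_le_sum_abs _ _).trans_eq (Finset.sum_congr rfl fun j _ => ?_)
        rw [abs_mul, abs_of_nonneg (N.w_nonneg _ _)]
      have hterm : ∀ j : Fin m, N.w i.succ j.succ * |u j| ≤ N.w i.succ j.succ * ‖u‖ :=
        fun j => mul_le_mul_of_nonneg_left (hle j) (N.w_nonneg _ _)
      have hrow : ∑ j : Fin m, N.w i.succ j.succ * ‖u‖ + N.w i.succ 0 * ‖u‖ = ‖u‖ := by
        rw [← Finset.sum_mul, ← add_mul, N.row_sum_eq_one hbal, one_mul]
      have hw0 := mul_nonneg (N.w_nonneg i.succ 0) hpos.le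
      revert ih hab
      refine Fin.cases (fun _ hab => ?_) (fun j ih hab => ?_) a
      · have := mul_pos hab hpos
        linarith [Finset.sum_le_sum fun j (_ : j ∈ Finset.univ) => hterm j]
      · rw [Fin.cons_succ] at ih
        have := Finset.sum_lt_sum (fun j (_ : j ∈ Finset.univ) => hterm j)
          ⟨j, Finset.mem_univ j, mul_lt_mul_of_pos_left ih hab⟩
        linarith
  have : ‖u‖ < ‖u‖ := (pi_norm_lt_iff hpos).2 fun i => by
    simpa using hlt i.succ (hreach.2 i)
  exact lt_irrefl _ this

end Network

theorem kronI_mulVec_apply (A : Matrix (Fin m) (Fin m) ℝ) (y : Fin m × Fin n → ℝ)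
    (i : Fin m) (a : Fin n) : (kronI A n *ᵥ y) (i, a) = ∑ j, A i j * y (j, a) := by
  simp [kronI, Matrix.mulVec, dotProduct, Fintype.sum_prod_type, Matrix.one_apply]

theorem replicate_mulVec_stackSource (E : Matrix (Fin q) (Fin r) ℝ) (y : Fin r → ℝ) :
    replicate m E *ᵥ stackSource m y = stackSource m (E *ᵥ y) := by
  ext ⟨i, a⟩
  simp [replicate, stackSource, Matrix.mulVec, dotProduct, Fintype.sum_prod_type,
    Matrix.one_apply]

/-- The two matrices act on different tensor factors. -/
theorem kronI_mul_replicate (A : Matrix (Fin m) (Fin m) ℝ) (E : Matrix (Fin n) (Fin n) ℝ) :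
    kronI A n * replicate m E = replicate m E * kronI A n := by
  rw [kronI, replicate, ← Matrix.mul_kronecker_mul, ← Matrix.mul_kronecker_mul, mul_one, one_mul,
    mul_one, one_mul]

theorem kronI_augLaplacian (N : Network m) (hbal : N.Balanced) :
    kronI N.augLaplacian n = 1 - kronI N.adjacency n := by
  rw [N.augLaplacian_eq_one_sub hbal, kronI, kronI,
    ← Matrix.one_kronecker_one]
  ext ia jb
  simp only [Matrix.sub_apply, Matrix.kroneckerMap_apply, sub_mul]

/-- By balance a kernel vector is fixed by `𝔸_m ⊗ I_n`, so the maximum principle applies to each of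
its `n` coordinates separately. -/
theorem kronI_augLaplacian_injective (N : Network m) (hbal : N.Balanced)
    (hreach : N.SourceReachable) {y : Fin m × Fin n → ℝ}
    (hy : kronI N.augLaplacian n *ᵥ y = 0) : y = 0 := by
  rw [kronI_augLaplacian N hbal, Matrix.sub_mulVec, Matrix.one_mulVec, sub_eq_zero] at hy
  ext ⟨i, a⟩
  refine congrFun (N.eq_zero_of_adjacency_fixed hbal hreach (u := fun i => y (i, a)) fun i => ?_) i
  conv_lhs => rw [hy]
  rw [kronI_mulVec_apply]
  rfl

/-- The sensing Laplacian annihilates `𝟏`, so both matrices have the same row sums. -/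
theorem kronI_sourceAdjacency_mulVec_stackSource (N : Network m) (y : Fin n → ℝ) :
    kronI N.sourceAdjacency n *ᵥ stackSource m y
      = kronI N.augLaplacian n *ᵥ stackSource m y := by
  ext ⟨i, a⟩
  rw [kronI_mulVec_apply, kronI_mulVec_apply]
  simp only [stackSource, ← Finset.sum_mul]
  congr 1
  simp [Network.augLaplacian, Network.laplacian, Network.degreeMatrix, Network.sourceAdjacency,
    Network.adjacency, Network.inDegree, Finset.sum_add_distrib, Matrix.diagonal_apply]

theorem hasDerivWithinAt_stackSource {f : ℝ → Fin q → ℝ} {f' : Fin q → ℝ} {s : Set ℝ} {t : ℝ}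
    (hf : HasDerivWithinAt f f' s t) :
    HasDerivWithinAt (fun τ => stackSource m (f τ)) (stackSource m f') s t :=
  hasDerivWithinAt_pi.2 fun ia => hasDerivWithinAt_pi.1 hf ia.2

theorem boundedSignal_stackSource {f : ℝ → Fin q → ℝ} (hf : BoundedSignal f) :
    BoundedSignal fun t => stackSource m (f t) :=
  boundedSignal_iff.2 fun ia => boundedSignal_iff.1 hf ia.2

/-- The node dynamics rewritten through the estimation and parameter errors. -/
theorem sensor_field_eq (N : Network m) (F₀ : Matrix (Fin n) (Fin n) ℝ)
    (G₀ : Matrix (Fin n) (Fin p) ℝ) (K : Matrix (Fin m × Fin n) (Fin m × Fin n) ℝ)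
    (Fh : Matrix (Fin m × Fin n) (Fin m × Fin n) ℝ)
    (Gh : Matrix (Fin m × Fin n) (Fin m × Fin p) ℝ)
    (x₀ : Fin n → ℝ) (x : Fin m × Fin n → ℝ) (v : Fin m × Fin p → ℝ) :
    K *ᵥ x + (Fh - K) *ᵥ aggregate N x₀ x + Gh *ᵥ v
      = K *ᵥ estError N x₀ x + replicate m F₀ *ᵥ aggregate N x₀ x
        + paramError F₀ Fh *ᵥ aggregate N x₀ x + replicate m G₀ *ᵥ v
        + paramError G₀ Gh *ᵥ v := by
  simp only [estError, paramError, Matrix.sub_mulVec, Matrix.mulVec_sub]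
  abel

/-- The error field of the network in terms of the parameter errors. -/
theorem error_field_eq (N : Network m) (hbal : N.Balanced) (F₀ : Matrix (Fin n) (Fin n) ℝ)
    (G₀ : Matrix (Fin n) (Fin p) ℝ) (H : Fin m → Matrix (Fin n) (Fin n) ℝ)
    (Fh : Matrix (Fin m × Fin n) (Fin m × Fin n) ℝ)
    (Gh : Matrix (Fin m × Fin n) (Fin m × Fin p) ℝ)
    (x₀ : Fin n → ℝ) (x : Fin m × Fin n → ℝ) (v : Fin p → ℝ) :
    estError N (F₀ *ᵥ x₀ + G₀ *ᵥ v)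
        (blockDiag H *ᵥ x + (Fh - blockDiag H) *ᵥ aggregate N x₀ x + Gh *ᵥ stackSource m v)
      = couplingOperator N H F₀ *ᵥ estError N x₀ x
        + kronI N.augLaplacian n *ᵥ (paramError F₀ Fh *ᵥ aggregate N x₀ x)
        + kronI N.augLaplacian n *ᵥ (paramError G₀ Gh *ᵥ stackSource m v) := by
  have hst : stackSource m (F₀ *ᵥ x₀ + G₀ *ᵥ v)
      = replicate m F₀ *ᵥ stackSource m x₀ + replicate m G₀ *ᵥ stackSource m v := by
    rw [replicate_mulVec_stackSource, replicate_mulVec_stackSource]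
    rfl
  have hG : kronI N.sourceAdjacency n *ᵥ (replicate m G₀ *ᵥ stackSource m v)
      = kronI N.augLaplacian n *ᵥ (replicate m G₀ *ᵥ stackSource m v) := by
    rw [replicate_mulVec_stackSource, kronI_sourceAdjacency_mulVec_stackSource]
  -- Eliminates the source state in favour of the aggregate. The `F₀` terms then combine to `F₀ (𝔸_m
  -- ⊗ I_n) (x̄ - z̄)`, the second summand of the coupling operator.
  have hF : kronI N.sourceAdjacency n *ᵥ (replicate m F₀ *ᵥ stackSource m x₀)
      = replicate m F₀ *ᵥ (aggregate N x₀ x - kronI N.adjacency n *ᵥ x) := by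
    rw [Matrix.mulVec_mulVec, kronI_mul_replicate, ← Matrix.mulVec_mulVec, aggregate,
      add_sub_cancel_left]
  have hA : ∀ y, kronI N.adjacency n *ᵥ (replicate m F₀ *ᵥ y)
      = replicate m F₀ *ᵥ (kronI N.adjacency n *ᵥ y) := fun y => by
    rw [Matrix.mulVec_mulVec, kronI_mul_replicate, ← Matrix.mulVec_mulVec]
  rw [sensor_field_eq N F₀ G₀]
  generalize hw : blockDiag H *ᵥ estError N x₀ x = w
  have hcoup : couplingOperator N H F₀ *ᵥ estError N x₀ x
      = kronI N.augLaplacian n *ᵥ w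
        + replicate m F₀ *ᵥ (kronI N.adjacency n *ᵥ estError N x₀ x) := by
    rw [couplingOperator, Matrix.add_mulVec, ← Matrix.mulVec_mulVec, ← Matrix.mulVec_mulVec, hw, hA]
  have hout : ∀ y, estError N (F₀ *ᵥ x₀ + G₀ *ᵥ v) y = y - (kronI N.adjacency n *ᵥ y
      + kronI N.sourceAdjacency n *ᵥ stackSource m (F₀ *ᵥ x₀ + G₀ *ᵥ v)) := fun _ => rfl
  rw [hcoup, hout, hst, Matrix.mulVec_add _ (replicate m F₀ *ᵥ _), hG, hF,
    kronI_augLaplacian N hbal, estError]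
  simp only [Matrix.sub_mulVec, Matrix.one_mulVec, Matrix.mulVec_add, Matrix.mulVec_sub, hA]
  abel

theorem hasDerivWithinAt_estError (N : Network m) {x₀ : ℝ → Fin n → ℝ}
    {x : ℝ → Fin m × Fin n → ℝ} {x₀' : Fin n → ℝ} {x' : Fin m × Fin n → ℝ} {s : Set ℝ} {t : ℝ}
    (hx₀ : HasDerivWithinAt x₀ x₀' s t) (hx : HasDerivWithinAt x x' s t) :
    HasDerivWithinAt (fun τ => estError N (x₀ τ) (x τ)) (estError N x₀' x') s t :=
  hx.sub ((hx.const_mulVec _).add ((hasDerivWithinAt_stackSource hx₀).const_mulVec _))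

theorem estError_eq_augLaplacian (N : Network m) (hbal : N.Balanced) (x₀ : Fin n → ℝ)
    (x : Fin m × Fin n → ℝ) :
    estError N x₀ x
      = kronI N.augLaplacian n *ᵥ x - kronI N.sourceAdjacency n *ᵥ stackSource m x₀ := by
  rw [kronI_augLaplacian N hbal, Matrix.sub_mulVec, Matrix.one_mulVec, estError, aggregate]
  abel

theorem IsClosedLoop.isErrorSystem {N : Network m} {F₀ : Matrix (Fin n) (Fin n) ℝ}
    {G₀ : Matrix (Fin n) (Fin p) ℝ} {H : Fin m → Matrix (Fin n) (Fin n) ℝ}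
    {P Q Γφ Γψ : Matrix (Fin m × Fin n) (Fin m × Fin n) ℝ}
    {v₀ : ℝ → Fin p → ℝ} {x₀ : ℝ → Fin n → ℝ} {x : ℝ → Fin m × Fin n → ℝ}
    {Fhat : ℝ → Matrix (Fin m × Fin n) (Fin m × Fin n) ℝ}
    {Ghat : ℝ → Matrix (Fin m × Fin n) (Fin m × Fin p) ℝ}
    (hsol : IsClosedLoop N F₀ G₀ H P Γφ Γψ v₀ x₀ x Fhat Ghat) (hbal : N.Balanced)
    (hP : P.PosDef) (hQ : Q.PosDef)
    (hlyap : (couplingOperator N H F₀)ᵀ * P + P * couplingOperator N H F₀ = -Q)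
    (hΓφ : Γφ.PosDef) (hΓψ : Γψ.PosDef) :
    IsErrorSystem (couplingOperator N H F₀) (kronI N.augLaplacian n) P Q Γφ Γψ
      (fun t => estError N (x₀ t) (x t)) (fun t => aggregate N (x₀ t) (x t))
      (fun t => stackSource m (v₀ t)) (fun t => paramError F₀ (Fhat t))
      (fun t => paramError G₀ (Ghat t)) where
  posDef_P := hP
  posDef_Q := hQ
  posDef_Γφ := hΓφ
  posDef_Γψ := hΓψ
  lyapunov := hlyap
  error t ht := (hasDerivWithinAt_estError N (hsol.source t ht) (hsol.sensors t ht)).congr_deriv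
    (error_field_eq N hbal F₀ G₀ H _ _ _ _ _)
  lawΦ := hsol.lawF
  lawΨ := hsol.lawG

end AdaptiveNetwork

/-! ### Assembly of the three conclusions. -/

theorem mainTheorem2 {m n p : ℕ} (N : AdaptiveNetwork.Network m)
    (F₀ : Matrix (Fin n) (Fin n) ℝ) (G₀ : Matrix (Fin n) (Fin p) ℝ)
    (H : Fin m → Matrix (Fin n) (Fin n) ℝ)
    (P Q Γφ Γψ : Matrix (Fin m × Fin n) (Fin m × Fin n) ℝ)
    (v₀ : ℝ → Fin p → ℝ) (x₀ : ℝ → Fin n → ℝ) (x : ℝ → Fin m × Fin n → ℝ)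
    (Fhat : ℝ → Matrix (Fin m × Fin n) (Fin m × Fin n) ℝ)
    (Ghat : ℝ → Matrix (Fin m × Fin n) (Fin m × Fin p) ℝ)
    (hbal : N.Balanced) (hreach : N.SourceReachable)
    (hH : ∀ i, AdaptiveNetwork.IsHurwitz (H i))
    (hcoupling : AdaptiveNetwork.IsHurwitz (AdaptiveNetwork.couplingOperator N H F₀))
    (hP : P.PosDef) (hQ : Q.PosDef)
    (hlyap : (AdaptiveNetwork.couplingOperator N H F₀)ᵀ * P
      + P * AdaptiveNetwork.couplingOperator N H F₀ = -Q)
    (hΓφ : Γφ.PosDef) (hΓψ : Γψ.PosDef)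
    (hsol : AdaptiveNetwork.IsClosedLoop N F₀ G₀ H P Γφ Γψ v₀ x₀ x Fhat Ghat) :
    -- the error and the adaptive parameters are bounded, whatever the source does
    (AdaptiveNetwork.BoundedSignal (fun t => AdaptiveNetwork.estError N (x₀ t) (x t)) ∧
      AdaptiveNetwork.BoundedMatrixSignal
        (fun t => AdaptiveNetwork.paramError F₀ (Fhat t)) ∧
      AdaptiveNetwork.BoundedMatrixSignal
        (fun t => AdaptiveNetwork.paramError G₀ (Ghat t)) ∧
      AdaptiveNetwork.BoundedMatrixSignal Fhat ∧
      AdaptiveNetwork.BoundedMatrixSignal Ghat) ∧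
    -- the node states and aggregates are bounded whenever the source state is
    (AdaptiveNetwork.BoundedSignal x₀ →
      AdaptiveNetwork.BoundedSignal x ∧
      AdaptiveNetwork.BoundedSignal
        (fun t => AdaptiveNetwork.aggregate N (x₀ t) (x t))) ∧
    -- the error vanishes asymptotically for every bounded input
    (AdaptiveNetwork.BoundedSignal v₀ →
      Filter.Tendsto (fun t => AdaptiveNetwork.estError N (x₀ t) (x t))
        Filter.atTop (𝓝 0)) := by
  have hsys := hsol.isErrorSystem hbal hP hQ hlyap hΓφ hΓψ
  obtain ⟨he, hΦ, hΨ⟩ := hsys.bounded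
  have hinj := fun y => AdaptiveNetwork.kronI_augLaplacian_injective (n := n) N hbal hreach (y := y)
  have hF : AdaptiveNetwork.BoundedMatrixSignal Fhat := by
    simpa [AdaptiveNetwork.paramError] using hΦ.add (.const (AdaptiveNetwork.replicate m F₀))
  have hG : AdaptiveNetwork.BoundedMatrixSignal Ghat := by
    simpa [AdaptiveNetwork.paramError] using hΨ.add (.const (AdaptiveNetwork.replicate m G₀))
  refine ⟨⟨he, hΦ, hΨ, hF, hG⟩, fun hx₀ => ?_, fun hv₀ => ?_⟩
  · set B := AdaptiveNetwork.kronI N.augLaplacian n with hB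
    -- Invertibility of `B` solves `B x̄ = ē + (𝔸_0 ⊗ I_n) x̄₀` for `x̄`.
    have hunit : IsUnit B := Matrix.mulVec_injective_iff_isUnit.1 fun y y' hyy' => by
      rw [← sub_eq_zero]
      exact hinj _ (by rw [Matrix.mulVec_sub, sub_eq_zero]; exact hyy')
    have hx : AdaptiveNetwork.BoundedSignal x := by
      refine ((he.add ((AdaptiveNetwork.boundedSignal_stackSource (m := m) hx₀).const_mulVec
        (AdaptiveNetwork.kronI N.sourceAdjacency n))).const_mulVec B⁻¹).congr fun t _ => ?_
      rw [AdaptiveNetwork.estError_eq_augLaplacian N hbal, sub_add_cancel, ← hB,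
        Matrix.mulVec_mulVec, Matrix.nonsing_inv_mul B ((Matrix.isUnit_iff_isUnit_det B).1 hunit),
        Matrix.one_mulVec]
    exact ⟨hx, (hx.sub he).congr fun t _ => by rw [AdaptiveNetwork.estError, sub_sub_cancel]⟩
  · have hv := AdaptiveNetwork.boundedSignal_stackSource (m := m) hv₀
    set B := AdaptiveNetwork.kronI N.augLaplacian n with hB
    set A := AdaptiveNetwork.couplingOperator N H F₀ with hA
    -- Since `z̄ = x̄ - ē`, its velocity is the node field minus the error field. `D` collects the
    -- coefficients of `z̄`, and `d` the terms in `ē` and `v̄₀`; both are bounded by the first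
    -- conclusion and the bound on the input.
    refine hsys.tendsto_zero hinj hv
      (D := fun t => AdaptiveNetwork.replicate m F₀ + AdaptiveNetwork.paramError F₀ (Fhat t)
        - B * AdaptiveNetwork.paramError F₀ (Fhat t))
      (d := fun t => AdaptiveNetwork.blockDiag H *ᵥ AdaptiveNetwork.estError N (x₀ t) (x t)
        + AdaptiveNetwork.replicate m G₀ *ᵥ AdaptiveNetwork.stackSource m (v₀ t)
        + AdaptiveNetwork.paramError G₀ (Ghat t) *ᵥ AdaptiveNetwork.stackSource m (v₀ t)
        - A *ᵥ AdaptiveNetwork.estError N (x₀ t) (x t)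
        - B *ᵥ (AdaptiveNetwork.paramError G₀ (Ghat t) *ᵥ AdaptiveNetwork.stackSource m (v₀ t)))
      (((AdaptiveNetwork.BoundedMatrixSignal.const _).add hΦ).sub (hΦ.const_mul B))
      (((((he.const_mulVec _).add (hv.const_mulVec _)).add (hv.mulVec hΨ)).sub
        (he.const_mulVec A)).sub ((hv.mulVec hΨ).const_mulVec B)) fun t ht => ?_
    have hz := (hsol.sensors t ht).sub (hsys.error t ht)
    rw [AdaptiveNetwork.sensor_field_eq N F₀ G₀] at hz
    have hfun : (fun s => AdaptiveNetwork.aggregate N (x₀ s) (x s))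
        = x - fun s => AdaptiveNetwork.estError N (x₀ s) (x s) := by
      ext1 s
      rw [Pi.sub_apply, AdaptiveNetwork.estError, sub_sub_cancel]
    rw [hfun]
    refine hz.congr_deriv ?_
    simp only [Matrix.add_mulVec, Matrix.sub_mulVec, ← Matrix.mulVec_mulVec]
    abel
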